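/- Let $m\ge 1$, let $E_1,\dots,E_m$ be (real) Banach lattices whose duals $E_1^*,\dots,E_m^*$ have the positive Schur property, that is, positive weakly null sequences in $E_j^*$ are norm null. Let $A\colon E_1\times\cdots\times E_m\to\mathbb R$ be a regular $m$-linear form, that is, a difference of two positive $m$-linear forms (such a form is automatically continuous). Let $A^{*[m+1]}\colon E_1^{**}\times\cdots\times E_m^{**}\to\mathbb R$ be the Aron-Berner extension $$A^{*[m+1]}(x_1^{**},\dots,x_m^{**})=\big(\overline{x_1^{**}}\circ\overline{x_2^{**}}\circ\cdots\circ\overline{x_m^{**}}\big)(A),$$ where, for $k=1,\dots,m$, the operator $\overline{x_k^{**}}$ maps a continuous $k$-linear form $B$ on $E_1\times\cdots\times E_k$ to the continuous $(k-1)$-linear form $(x_1,\dots,x_{k-1})\mapsto x_k^{**}\big(B(x_1,\dots,x_{k-1},\bullet)\big)$ (a real number if $k=1$). Then $$A^{*[m+1]}(x_{1,n}^{**},\dots,x_{m,n}^{**})\longrightarrow 0\quad (n\to\infty)$$ for every positive weak$^*$-null sequence $(x_{m,n}^{**})_{n=1}^\infty$ in $E_m^{**}$ and all bounded sequences $(x_{k,n}^{**})_{n=1}^\infty$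 in $E_k^{**}$, $k=1,\dots,m-1$. In particular, $A$ and $A^{*[m+1]}$ are almost Dunford-Pettis, where an $m$-linear form $B\colon F_1\times\cdots\times F_m\to\mathbb R$ on Banach lattices is almost Dunford-Pettis if $B(x_{1,n},\dots,x_{m,n})\to 0$ whenever $(x_{j,n})_{n=1}^\infty$ is a disjoint weakly null sequence in $F_j$ for $j=1,\dots,m$. -/

import Mathlib

open Filter Topology

set_option linter.unusedSectionVars false

/-!
A Banach lattice is a complete real normed space with a lattice order compatible with the vector
space structure (`IsOrderedAddMonoid`, `IsOrderedModule ℝ`) and a solid norm (`HasSolidNorm`).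
-/

noncomputable section DualLattice

/-! ### The dual of a Banach lattice, with its usual order, is a Banach lattice -/

variable {E : Type*} [NormedAddCommGroup E] [NormedSpace ℝ E] [Lattice E] [IsOrderedAddMonoid E]
  [HasSolidNorm E]

/-- The order of the dual: `f ≤ g` iff `f x ≤ g x` for every `x ≥ 0`. -/
instance dualPartialOrder : PartialOrder (StrongDual ℝ E) where
  le f g := ∀ x : E, 0 ≤ x → f x ≤ g x
  le_refl f x _ := le_rfl
  le_trans f g h hfg hgh x hx := (hfg x hx).trans (hgh x hx)
  le_antisymm f g hfg hgf := by
    have key : ∀ x : E, 0 ≤ x → f x = g x := fun x hx => le_antisymm (hfg x hx) (hgf x hx)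
    ext x
    rw [← posPart_sub_negPart x, map_sub, map_sub, key _ (posPart_nonneg x),
      key _ (negPart_nonneg x)]

theorem dual_le_iff (f g : StrongDual ℝ E) : f ≤ g ↔ ∀ x : E, 0 ≤ x → f x ≤ g x := Iff.rfl

theorem dual_nonneg_iff (f : StrongDual ℝ E) : 0 ≤ f ↔ ∀ x : E, 0 ≤ x → 0 ≤ f x := Iff.rfl

/-- The value of the positive part of `f` at `x ≥ 0`. -/
def dualPosPartAux (f : StrongDual ℝ E) (x : E) : ℝ := sSup (f '' Set.Icc 0 x)

theorem norm_le_norm_of_nonneg_le {x y : E} (hx : 0 ≤ x) (hxy : x ≤ y) : ‖x‖ ≤ ‖y‖ :=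
  norm_le_norm_of_abs_le_abs (by rwa [abs_of_nonneg hx, abs_of_nonneg (hx.trans hxy)])

theorem dualPosPartAux_bddAbove (f : StrongDual ℝ E) (x : E) :
    BddAbove (f '' Set.Icc 0 x) := by
  refine ⟨‖f‖ * ‖x‖, ?_⟩
  rintro _ ⟨y, hy, rfl⟩
  exact (le_abs_self _).trans ((f.le_opNorm y).trans
    (mul_le_mul_of_nonneg_left (norm_le_norm_of_nonneg_le hy.1 hy.2) (norm_nonneg f)))

theorem le_dualPosPartAux (f : StrongDual ℝ E) {x y : E} (hy : 0 ≤ y) (hyx : y ≤ x) :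
    f y ≤ dualPosPartAux f x :=
  le_csSup (dualPosPartAux_bddAbove f x) ⟨y, ⟨hy, hyx⟩, rfl⟩

theorem dualPosPartAux_le (f : StrongDual ℝ E) {x : E} (hx : 0 ≤ x) {c : ℝ}
    (h : ∀ y, 0 ≤ y → y ≤ x → f y ≤ c) : dualPosPartAux f x ≤ c := by
  refine csSup_le ⟨f 0, 0, ⟨le_rfl, hx⟩, rfl⟩ ?_
  rintro _ ⟨y, hy, rfl⟩
  exact h y hy.1 hy.2

theorem dualPosPartAux_nonneg (f : StrongDual ℝ E) {x : E} (hx : 0 ≤ x) :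
    0 ≤ dualPosPartAux f x := by
  simpa using le_dualPosPartAux f le_rfl hx

theorem dualPosPartAux_le_norm (f : StrongDual ℝ E) {x : E} (hx : 0 ≤ x) :
    dualPosPartAux f x ≤ ‖f‖ * ‖x‖ :=
  dualPosPartAux_le f hx fun y hy hyx => (le_abs_self _).trans ((f.le_opNorm y).trans
    (mul_le_mul_of_nonneg_left (norm_le_norm_of_nonneg_le hy hyx) (norm_nonneg f)))

theorem dualPosPartAux_add (f : StrongDual ℝ E) {x y : E} (hx : 0 ≤ x) (hy : 0 ≤ y) :
    dualPosPartAux f (x + y) = dualPosPartAux f x + dualPosPartAux f y := by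
  apply le_antisymm
  · refine dualPosPartAux_le f (add_nonneg hx hy) fun z hz hzxy => ?_
    have h1 : f (z ⊓ x) ≤ dualPosPartAux f x := le_dualPosPartAux f (le_inf hz hx) inf_le_right
    have h2 : f (z - z ⊓ x) ≤ dualPosPartAux f y := by
      refine le_dualPosPartAux f (sub_nonneg.2 inf_le_left) ?_
      rw [sub_le_iff_le_add', inf_add]
      exact le_inf (le_add_of_nonneg_right hy) hzxy
    have h3 : f z = f (z ⊓ x) + f (z - z ⊓ x) := by rw [← map_add, add_sub_cancel]
    linarith
  · rw [← le_sub_iff_add_le]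
    refine dualPosPartAux_le f hx fun u hu hux => ?_
    rw [le_sub_comm]
    refine dualPosPartAux_le f hy fun v hv hvy => ?_
    rw [le_sub_iff_add_le', ← map_add]
    exact le_dualPosPartAux f (add_nonneg hu hv) (add_le_add hux hvy)

theorem dualPosPartAux_sub (f : StrongDual ℝ E) {x a b : E} (ha : 0 ≤ a) (hb : 0 ≤ b)
    (h : x = a - b) :
    dualPosPartAux f x⁺ - dualPosPartAux f x⁻ = dualPosPartAux f a - dualPosPartAux f b := by
  have h1 : x⁺ + b = a + x⁻ := by
    have := posPart_sub_negPart x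
    rw [h] at this ⊢
    rw [sub_eq_iff_eq_add] at this
    rw [this]; abel
  have h2 := dualPosPartAux_add f (posPart_nonneg x) hb
  rw [h1, dualPosPartAux_add f ha (negPart_nonneg x)] at h2
  linarith

/-- The positive part of a functional, as an additive map. -/
def dualPosPartHom (f : StrongDual ℝ E) : E →+ ℝ :=
  AddMonoidHom.mk' (fun x => dualPosPartAux f x⁺ - dualPosPartAux f x⁻) fun x y => by
    rw [dualPosPartAux_sub f (add_nonneg (posPart_nonneg x) (posPart_nonneg y))
      (add_nonneg (negPart_nonneg x) (negPart_nonneg y)),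
      dualPosPartAux_add f (posPart_nonneg x) (posPart_nonneg y),
      dualPosPartAux_add f (negPart_nonneg x) (negPart_nonneg y)]
    · ring
    · conv_lhs => rw [← posPart_sub_negPart x, ← posPart_sub_negPart y]
      abel

theorem dualPosPartHom_apply (f : StrongDual ℝ E) (x : E) :
    dualPosPartHom f x = dualPosPartAux f x⁺ - dualPosPartAux f x⁻ := rfl

theorem dualPosPartHom_continuous (f : StrongDual ℝ E) : Continuous (dualPosPartHom f) := by
  refine AddMonoidHomClass.continuous_of_bound (dualPosPartHom f) ‖f‖ fun x => ?_
  have hp : ‖x⁺‖ ≤ ‖x‖ := norm_le_norm_of_abs_le_abs (by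
    rw [abs_of_nonneg (posPart_nonneg x)]; exact sup_le (le_abs_self x) (abs_nonneg x))
  have hn : ‖x⁻‖ ≤ ‖x‖ := norm_le_norm_of_abs_le_abs (by
    rw [abs_of_nonneg (negPart_nonneg x)]; exact sup_le (neg_le_abs x) (abs_nonneg x))
  have h1 := dualPosPartAux_le_norm f (posPart_nonneg x)
  have h2 := dualPosPartAux_le_norm f (negPart_nonneg x)
  have h3 := dualPosPartAux_nonneg f (posPart_nonneg x)
  have h4 := dualPosPartAux_nonneg f (negPart_nonneg x)
  have h5 := mul_le_mul_of_nonneg_left hp (norm_nonneg f)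
  have h6 := mul_le_mul_of_nonneg_left hn (norm_nonneg f)
  rw [dualPosPartHom_apply, Real.norm_eq_abs, abs_le]
  constructor <;> linarith

/-- The positive part of a functional. -/
def dualPosPart (f : StrongDual ℝ E) : StrongDual ℝ E :=
  (dualPosPartHom f).toRealLinearMap (dualPosPartHom_continuous f)

theorem dualPosPart_apply_of_nonneg (f : StrongDual ℝ E) {x : E} (hx : 0 ≤ x) :
    dualPosPart f x = dualPosPartAux f x := by
  change dualPosPartHom f x = _
  have : dualPosPartAux f (0 : E) = 0 := by simp [dualPosPartAux]
  rw [dualPosPartHom_apply, posPart_of_nonneg hx, negPart_of_nonneg hx, this, sub_zero]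

/-- The dual of a normed lattice is a lattice. -/
instance dualLattice : Lattice (StrongDual ℝ E) :=
  { dualPartialOrder with
    sup := fun f g => f + dualPosPart (g - f)
    inf := fun f g => f - dualPosPart (f - g)
    le_sup_left := fun f g x hx => by
      have := dualPosPartAux_nonneg (g - f) hx
      rw [_root_.add_apply, dualPosPart_apply_of_nonneg _ hx]
      linarith
    le_sup_right := fun f g x hx => by
      have := le_dualPosPartAux (g - f) hx le_rfl
      rw [_root_.sub_apply] at this
      rw [_root_.add_apply, dualPosPart_apply_of_nonneg _ hx]
      linarith
    sup_le := fun f g h hfh hgh x hx => by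
      have : dualPosPartAux (g - f) x ≤ h x - f x := by
        refine dualPosPartAux_le _ hx fun y hy hyx => ?_
        have h1 := hgh y hy
        have h2 := hfh (x - y) (sub_nonneg.2 hyx)
        rw [map_sub, map_sub] at h2
        rw [_root_.sub_apply]
        linarith
      rw [_root_.add_apply, dualPosPart_apply_of_nonneg _ hx]
      linarith
    inf_le_left := fun f g x hx => by
      have := dualPosPartAux_nonneg (f - g) hx
      rw [_root_.sub_apply, dualPosPart_apply_of_nonneg _ hx]
      linarith
    inf_le_right := fun f g x hx => by
      have := le_dualPosPartAux (f - g) hx le_rfl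
      rw [_root_.sub_apply] at this
      rw [_root_.sub_apply, dualPosPart_apply_of_nonneg _ hx]
      linarith
    le_inf := fun h f g hhf hhg x hx => by
      have : dualPosPartAux (f - g) x ≤ f x - h x := by
        refine dualPosPartAux_le _ hx fun y hy hyx => ?_
        have h1 := hhg y hy
        have h2 := hhf (x - y) (sub_nonneg.2 hyx)
        rw [map_sub, map_sub] at h2
        rw [_root_.sub_apply]
        linarith
      rw [_root_.sub_apply, dualPosPart_apply_of_nonneg _ hx]
      linarith }

theorem dual_sup_def (f g : StrongDual ℝ E) : f ⊔ g = f + dualPosPart (g - f) := rfl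

instance dualIsOrderedAddMonoid : IsOrderedAddMonoid (StrongDual ℝ E) where
  add_le_add_left f g hfg h x hx := by
    simpa using hfg x hx

instance dualIsOrderedModule : IsOrderedModule ℝ (StrongDual ℝ E) where
  smul_le_smul_of_nonneg_left := fun c hc f g hfg x hx => by
    simpa using mul_le_mul_of_nonneg_left (hfg x hx) hc
  smul_le_smul_of_nonneg_right := fun f hf c d hcd x hx => by
    simpa using mul_le_mul_of_nonneg_right hcd (hf x hx)

theorem dual_abs_apply_le_norm (f : StrongDual ℝ E) {x : E} (hx : 0 ≤ x) :
    |f| x ≤ ‖f‖ * ‖x‖ := by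
  change (f ⊔ -f) x ≤ _
  rw [dual_sup_def, _root_.add_apply, dualPosPart_apply_of_nonneg _ hx,
    ← le_sub_iff_add_le']
  refine dualPosPartAux_le _ hx fun y hy hyx => ?_
  have h1 : |x - (2 : ℕ) • y| ≤ x := by
    rw [abs_le', two_nsmul]
    constructor
    · exact sub_le_self _ (add_nonneg hy hy)
    · rw [neg_sub, sub_le_iff_le_add]
      exact add_le_add hyx hyx
  have h2 : ‖x - (2 : ℕ) • y‖ ≤ ‖x‖ :=
    norm_le_norm_of_abs_le_abs (h1.trans (le_abs_self x))
  have h3 : f (x - (2 : ℕ) • y) ≤ ‖f‖ * ‖x‖ := (le_abs_self _).trans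
    ((f.le_opNorm _).trans (mul_le_mul_of_nonneg_left h2 (norm_nonneg f)))
  rw [map_sub, map_nsmul, two_nsmul] at h3
  simp only [_root_.sub_apply, _root_.neg_apply]
  linarith

theorem dual_abs_apply_le (f : StrongDual ℝ E) (x : E) : |f x| ≤ |f| |x| := by
  have h1 : ∀ y : E, 0 ≤ y → |f y| ≤ |f| y := fun y hy =>
    abs_le'.2 ⟨le_abs_self f y hy, by simpa using neg_le_abs f y hy⟩
  have h2 := h1 _ (posPart_nonneg x)
  have h3 := h1 _ (negPart_nonneg x)
  have h4 : |f x| ≤ |f x⁺| + |f x⁻| := by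
    conv_lhs => rw [← posPart_sub_negPart x, map_sub]
    exact abs_sub _ _
  rw [← posPart_add_negPart x, map_add]
  linarith

instance dualHasSolidNorm : HasSolidNorm (StrongDual ℝ E) where
  solid f g hfg := by
    refine f.opNorm_le_bound (norm_nonneg g) fun x => ?_
    calc ‖f x‖ ≤ |f| |x| := dual_abs_apply_le f x
      _ ≤ |g| |x| := hfg _ (abs_nonneg x)
      _ ≤ ‖g‖ * ‖|x|‖ := dual_abs_apply_le_norm g (abs_nonneg x)
      _ = ‖g‖ * ‖x‖ := by rw [norm_abs_eq_norm]

end DualLattice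

/-- The bidual `E**`. -/
abbrev Bidual (E : Type*) [NormedAddCommGroup E] [NormedSpace ℝ E] : Type _ :=
  StrongDual ℝ (StrongDual ℝ E)

/-! ### Sequences in Banach lattices -/

section Sequences

/-- A weakly null sequence. -/
def WeaklyNull {E : Type*} [NormedAddCommGroup E] [NormedSpace ℝ E] (x : ℕ → E) : Prop :=
  Tendsto (fun n => toWeakSpace ℝ E (x n)) atTop (𝓝 0)

theorem weaklyNull_iff {E : Type*} [NormedAddCommGroup E] [NormedSpace ℝ E] (x : ℕ → E) :
    WeaklyNull x ↔ ∀ f : StrongDual ℝ E, Tendsto (fun n => f (x n)) atTop (𝓝 0) := by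
  have h : IsInducing fun (y : WeakSpace ℝ E) (f : StrongDual ℝ E) =>
      f ((toWeakSpace ℝ E).symm y) := ⟨rfl⟩
  rw [WeaklyNull, h.tendsto_nhds_iff, tendsto_pi_nhds]
  simp

/-- A weak*-null sequence in the dual of `E`. -/
def WeakStarNull {E : Type*} [NormedAddCommGroup E] [NormedSpace ℝ E]
    (f : ℕ → StrongDual ℝ E) : Prop :=
  Tendsto (fun n => StrongDual.toWeakDual (f n)) atTop (𝓝 0)

theorem weakStarNull_iff {E : Type*} [NormedAddCommGroup E] [NormedSpace ℝ E]
    (f : ℕ → StrongDual ℝ E) :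
    WeakStarNull f ↔ ∀ x : E, Tendsto (fun n => f n x) atTop (𝓝 0) :=
  tendsto_iff_forall_eval_tendsto_topDualPairing

/-- A (pairwise) disjoint sequence in a vector lattice. -/
def DisjointSeq {E : Type*} [AddCommGroup E] [Lattice E] (x : ℕ → E) : Prop :=
  Pairwise fun n k => |x n| ⊓ |x k| = 0

/-- The positive Schur property: positive weakly null sequences are norm null. -/
def PositiveSchur (E : Type*) [NormedAddCommGroup E] [NormedSpace ℝ E] [Lattice E] : Prop :=
  ∀ x : ℕ → E, (∀ n, 0 ≤ x n) → WeaklyNull x → Tendsto x atTop (𝓝 0)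

end Sequences

/-! ### Multilinear operators -/

section Multilinear

/-- A positive multilinear form. -/
def IsPositiveForm {ι : Type*} {E : ι → Type*} [∀ i, NormedAddCommGroup (E i)]
    [∀ i, NormedSpace ℝ (E i)] [∀ i, Lattice (E i)] (A : MultilinearMap ℝ E ℝ) : Prop :=
  ∀ x : ∀ i, E i, (∀ i, 0 ≤ x i) → 0 ≤ A x

/-- A regular multilinear form: a difference of two positive ones. -/
def IsRegularForm {ι : Type*} {E : ι → Type*} [∀ i, NormedAddCommGroup (E i)]
    [∀ i, NormedSpace ℝ (E i)] [∀ i, Lattice (E i)] (A : MultilinearMap ℝ E ℝ) : Prop :=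
  ∃ A₁ A₂ : MultilinearMap ℝ E ℝ, IsPositiveForm A₁ ∧ IsPositiveForm A₂ ∧ A = A₁ - A₂

/-- An almost Dunford-Pettis multilinear operator. -/
def AlmostDunfordPettis {ι : Type*} {E : ι → Type*} [∀ i, NormedAddCommGroup (E i)]
    [∀ i, NormedSpace ℝ (E i)] [∀ i, Lattice (E i)] {G : Type*} [NormedAddCommGroup G]
    [NormedSpace ℝ G] (A : MultilinearMap ℝ E G) : Prop :=
  ∀ x : ∀ i, ℕ → E i, (∀ i, DisjointSeq (x i)) → (∀ i, WeaklyNull (x i)) →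
    Tendsto (fun n => A fun i => x i n) atTop (𝓝 0)

end Multilinear

/-! ### The Aron-Berner extension `A^{*[m+1]}` of a multilinear form -/

noncomputable section AronBerner

universe u

/-- For `z ∈ E_{n+1}**`, the operator `L(E_1, …, E_{n+1}) → L(E_1, …, E_n)` that sends `A` to
`(x_1, …, x_n) ↦ z (A (x_1, …, x_n, •))`. -/
def bidualBar {n : ℕ} {E : Fin (n + 1) → Type u} [∀ i, NormedAddCommGroup (E i)]
    [∀ i, NormedSpace ℝ (E i)] (z : Bidual (E (Fin.last n)))
    (A : ContinuousMultilinearMap ℝ E ℝ) :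
    ContinuousMultilinearMap ℝ (fun i : Fin n => E i.castSucc) ℝ :=
  z.compContinuousMultilinearMap A.curryRight

/-- The value of `A^{*[n+1]}` at `z`: the operators `bidualBar` are applied with `z_n` first,
then `z_{n-1}`, and so on down to `z_1`; a form in no variables is identified with its value. -/
def aronBernerFun : ∀ (n : ℕ) (E : Fin n → Type u) [∀ i, NormedAddCommGroup (E i)]
    [∀ i, NormedSpace ℝ (E i)],
    ContinuousMultilinearMap ℝ E ℝ → (∀ i, Bidual (E i)) → ℝ
  | 0, _, _, _, A, _ => A fun i => i.elim0
  | n + 1, E, _, _, A, z =>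
    aronBernerFun n (fun i : Fin n => E i.castSucc) (bidualBar (z (Fin.last n)) A)
      fun i => z i.castSucc

section

variable {n : ℕ} {E : Fin (n + 1) → Type u} [∀ i, NormedAddCommGroup (E i)]
  [∀ i, NormedSpace ℝ (E i)]

theorem bidualBar_apply (z : Bidual (E (Fin.last n))) (A : ContinuousMultilinearMap ℝ E ℝ)
    (x : ∀ i : Fin n, E i.castSucc) : bidualBar z A x = z (A.curryRight x) := rfl

theorem bidualBar_apply_add (z : Bidual (E (Fin.last n))) (A B : ContinuousMultilinearMap ℝ E ℝ) :
    bidualBar z (A + B) = bidualBar z A + bidualBar z B := by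
  ext x
  exact map_add z (A.curryRight x) (B.curryRight x)

theorem bidualBar_apply_smul (z : Bidual (E (Fin.last n))) (c : ℝ)
    (A : ContinuousMultilinearMap ℝ E ℝ) : bidualBar z (c • A) = c • bidualBar z A := by
  ext x
  exact map_smul z c (A.curryRight x)

theorem bidualBar_add (z w : Bidual (E (Fin.last n))) (A : ContinuousMultilinearMap ℝ E ℝ) :
    bidualBar (z + w) A = bidualBar z A + bidualBar w A := rfl

theorem bidualBar_smul (c : ℝ) (z : Bidual (E (Fin.last n))) (A : ContinuousMultilinearMap ℝ E ℝ) :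
    bidualBar (c • z) A = c • bidualBar z A := rfl

end

theorem aronBernerFun_apply_add : ∀ (n : ℕ) (E : Fin n → Type u) [∀ i, NormedAddCommGroup (E i)]
    [∀ i, NormedSpace ℝ (E i)] (A B : ContinuousMultilinearMap ℝ E ℝ) (z : ∀ i, Bidual (E i)),
    aronBernerFun n E (A + B) z = aronBernerFun n E A z + aronBernerFun n E B z
  | 0, _, _, _, _, _, _ => rfl
  | n + 1, E, _, _, A, B, z => by
    simp only [aronBernerFun, bidualBar_apply_add]
    exact aronBernerFun_apply_add n _ _ _ _

theorem aronBernerFun_apply_smul : ∀ (n : ℕ) (E : Fin n → Type u) [∀ i, NormedAddCommGroup (E i)]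
    [∀ i, NormedSpace ℝ (E i)] (c : ℝ) (A : ContinuousMultilinearMap ℝ E ℝ)
    (z : ∀ i, Bidual (E i)), aronBernerFun n E (c • A) z = c * aronBernerFun n E A z
  | 0, _, _, _, _, _, _ => rfl
  | n + 1, E, _, _, c, A, z => by
    simp only [aronBernerFun, bidualBar_apply_smul]
    exact aronBernerFun_apply_smul n _ _ _ _

theorem aronBernerFun_update_add : ∀ (n : ℕ) (E : Fin n → Type u)
    [∀ i, NormedAddCommGroup (E i)] [∀ i, NormedSpace ℝ (E i)]
    (A : ContinuousMultilinearMap ℝ E ℝ) (z : ∀ i, Bidual (E i)) (i : Fin n)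
    (a b : Bidual (E i)),
    aronBernerFun n E A (Function.update z i (a + b)) =
      aronBernerFun n E A (Function.update z i a) + aronBernerFun n E A (Function.update z i b)
  | 0, _, _, _, _, _, i, _, _ => i.elim0
  | n + 1, E, _, _, A, z, i, a, b => by
    induction i using Fin.lastCases with
    | last =>
      simp only [aronBernerFun, Function.update_self, bidualBar_add, aronBernerFun_apply_add]
      have h (c : Bidual (E (Fin.last n))) :
          (fun i : Fin n => Function.update z (Fin.last n) c i.castSucc) =
            fun i : Fin n => z i.castSucc := Fin.init_update_last z c
      rw [h, h, h]
    | cast i =>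
      have h (c : Bidual (E i.castSucc)) :
          (fun j : Fin n => Function.update z i.castSucc c j.castSucc) =
            Function.update (fun j : Fin n => z j.castSucc) i c := Fin.init_update_castSucc z i c
      simp only [aronBernerFun, h, Function.update_of_ne (Fin.castSucc_lt_last i).ne']
      exact aronBernerFun_update_add n (fun j : Fin n => E j.castSucc) _ _ i a b

theorem aronBernerFun_update_smul : ∀ (n : ℕ) (E : Fin n → Type u)
    [∀ i, NormedAddCommGroup (E i)] [∀ i, NormedSpace ℝ (E i)]
    (A : ContinuousMultilinearMap ℝ E ℝ) (z : ∀ i, Bidual (E i)) (i : Fin n) (c : ℝ)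
    (a : Bidual (E i)),
    aronBernerFun n E A (Function.update z i (c • a)) =
      c * aronBernerFun n E A (Function.update z i a)
  | 0, _, _, _, _, _, i, _, _ => i.elim0
  | n + 1, E, _, _, A, z, i, c, a => by
    induction i using Fin.lastCases with
    | last =>
      simp only [aronBernerFun, Function.update_self, bidualBar_smul, aronBernerFun_apply_smul]
      have h (c : Bidual (E (Fin.last n))) :
          (fun i : Fin n => Function.update z (Fin.last n) c i.castSucc) =
            fun i : Fin n => z i.castSucc := Fin.init_update_last z c
      rw [h, h]
    | cast i =>
      have h (c : Bidual (E i.castSucc)) :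
          (fun j : Fin n => Function.update z i.castSucc c j.castSucc) =
            Function.update (fun j : Fin n => z j.castSucc) i c := Fin.init_update_castSucc z i c
      simp only [aronBernerFun, h, Function.update_of_ne (Fin.castSucc_lt_last i).ne']
      exact aronBernerFun_update_smul n (fun j : Fin n => E j.castSucc) _ _ i c a

/-- The Aron-Berner extension `A^{*[n+1]} : E_1** × ⋯ × E_n** → ℝ` of a continuous `n`-linear
form `A` on `E_1 × ⋯ × E_n`. -/
def aronBerner {n : ℕ} {E : Fin n → Type u} [∀ i, NormedAddCommGroup (E i)]
    [∀ i, NormedSpace ℝ (E i)] (A : ContinuousMultilinearMap ℝ E ℝ) :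
    MultilinearMap ℝ (fun i => Bidual (E i)) ℝ :=
  MultilinearMap.mk' (aronBernerFun n E A)
    (fun z i a b => aronBernerFun_update_add n E A z i a b)
    (fun z i c a => aronBernerFun_update_smul n E A z i c a)

theorem aronBerner_zero {E : Fin 0 → Type u} [∀ i, NormedAddCommGroup (E i)]
    [∀ i, NormedSpace ℝ (E i)] (A : ContinuousMultilinearMap ℝ E ℝ) (z : ∀ i, Bidual (E i)) :
    aronBerner A z = A fun i => i.elim0 := rfl

theorem aronBerner_succ {n : ℕ} {E : Fin (n + 1) → Type u} [∀ i, NormedAddCommGroup (E i)]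
    [∀ i, NormedSpace ℝ (E i)] (A : ContinuousMultilinearMap ℝ E ℝ) (z : ∀ i, Bidual (E i)) :
    aronBerner A z = aronBerner (bidualBar (z (Fin.last n)) A) fun i => z i.castSucc := rfl

end AronBerner

/-! Only the last variable matters: the extension contracts it first, and what remains is bounded by
`‖bidualBar (z n) A‖` times the norms of the other arguments. The goal is therefore norm convergence
of the contracted forms. Splitting `A`, with automatic continuity of positive forms, reduces this to
positive `A`; then it is enough that `z n (v n) → 0` for `v n = A (x n, •)`, with `x n` positive in
the unit balls. If this fails, a sequence `w k` of the functionals `v n` with `z n (v n) ≥ ε` is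
disjointified: `w k ≤ y k + (error)`, where the `y k ≤ w k` are positive and disjoint and the chosen
`z n` are small on the error. If `y k` is weakly null, the positive Schur property makes it norm
null, contradicting `ε`. For weak nullity (`weaklyNull_of_disjoint_le_curryRight`), a positive `φ`
in the bidual splits into parts `ψ k` living on the bands of the `y k`, with sums at most `φ`. Then
`φ (y k) ≤ ψ k (A (x k, •))`, and the forms `bidualBar (ψ k) A` have partial sums below `bidualBar φ
A`. Such a series tends to zero along bounded positive sequences (`tendsto_apply_of_sum_le`), by
induction on the number of variables, each step using the Schur property of one dual. -/

/-! ### Disjointness in lattice-ordered groups. -/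

section LatticeLemmas

variable {F : Type*} [AddCommGroup F] [Lattice F] [IsOrderedAddMonoid F]

theorem inf_add_le_inf_add_inf {a b c : F} (ha : 0 ≤ a) (hb : 0 ≤ b) (hc : 0 ≤ c) :
    a ⊓ (b + c) ≤ a ⊓ b + a ⊓ c := by
  have h1 : a ⊓ (b + c) ≤ a ⊓ b + c := by
    rw [← sub_le_iff_le_add]
    refine le_inf ?_ ?_
    · exact (sub_le_self _ hc).trans inf_le_left
    · rw [sub_le_iff_le_add]; exact inf_le_right
  rw [add_inf]
  exact le_inf (inf_le_left.trans (le_add_of_nonneg_left (le_inf ha hb))) h1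

theorem inf_add_eq_zero {a b c : F} (ha : 0 ≤ a) (hb : 0 ≤ b) (hc : 0 ≤ c) (hab : a ⊓ b = 0)
    (hac : a ⊓ c = 0) : a ⊓ (b + c) = 0 := by
  refine le_antisymm ?_ (le_inf ha (add_nonneg hb hc))
  simpa [hab, hac] using inf_add_le_inf_add_inf ha hb hc

theorem inf_nsmul_eq_zero {a b : F} (ha : 0 ≤ a) (hb : 0 ≤ b) (hab : a ⊓ b = 0) (n : ℕ) :
    a ⊓ (n • b) = 0 := by
  induction n with
  | zero => simpa using ha
  | succ n ih =>
    rw [succ_nsmul]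
    exact inf_add_eq_zero ha (nsmul_nonneg hb n) hb ih hab

theorem inf_sum_eq_zero {ι : Type*} {a : F} (ha : 0 ≤ a) {u : ι → F} (hu : ∀ k, 0 ≤ u k)
    (s : Finset ι) (h : ∀ k ∈ s, a ⊓ u k = 0) : a ⊓ (∑ k ∈ s, u k) = 0 := by
  classical
  induction s using Finset.induction_on with
  | empty => simpa using ha
  | insert k s hk ih =>
    rw [Finset.sum_insert hk]
    exact inf_add_eq_zero ha (hu k) (Finset.sum_nonneg fun i _ => hu i)
      (h k (Finset.mem_insert_self k s)) (ih fun i hi => h i (Finset.mem_insert_of_mem hi))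

theorem inf_eq_zero_of_le {a b c d : F} (hc : 0 ≤ c) (hd : 0 ≤ d) (hca : c ≤ a) (hdb : d ≤ b)
    (hab : a ⊓ b = 0) : c ⊓ d = 0 :=
  le_antisymm ((inf_le_inf hca hdb).trans hab.le) (le_inf hc hd)

/-- A sum of pairwise disjoint positive elements below `x` is below `x`. -/
theorem sum_le_of_disjoint {x : F} (hx : 0 ≤ x) {u : ℕ → F} (hu : ∀ k, 0 ≤ u k)
    (hd : Pairwise fun i j => u i ⊓ u j = 0) (hux : ∀ k, u k ≤ x) (N : ℕ) :
    ∑ k ∈ Finset.range N, u k ≤ x := by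
  induction N with
  | zero => simpa using hx
  | succ N ih =>
    have h0 : u N ⊓ ∑ k ∈ Finset.range N, u k = 0 :=
      inf_sum_eq_zero (hu N) hu _ fun k hk => hd (Finset.mem_range.1 hk).ne'
    -- For disjoint elements the sum is the supremum.
    rw [Finset.sum_range_succ, add_comm, ← inf_add_sup, h0, zero_add]
    exact sup_le (hux N) ih

end LatticeLemmas

/-! ### Band parts of positive functionals, and disjoint weakly null sequences. -/

section Functionals

variable {E : Type*} [NormedAddCommGroup E] [NormedSpace ℝ E] [Lattice E] [IsOrderedAddMonoid E]
  [HasSolidNorm E]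

theorem norm_posPart_le (x : E) : ‖x⁺‖ ≤ ‖x‖ := norm_le_norm_of_abs_le_abs (by
  rw [abs_of_nonneg (posPart_nonneg x)]; exact sup_le (le_abs_self x) (abs_nonneg x))

theorem norm_negPart_le (x : E) : ‖x⁻‖ ≤ ‖x‖ := norm_le_norm_of_abs_le_abs (by
  rw [abs_of_nonneg (negPart_nonneg x)]; exact sup_le (neg_le_abs x) (abs_nonneg x))

/-- An additive, positive, bounded function on the positive cone extends to a functional. -/
theorem exists_strongDual_of_cone (p : E → ℝ) (C : ℝ)
    (hadd : ∀ x y, 0 ≤ x → 0 ≤ y → p (x + y) = p x + p y) (hpos : ∀ x, 0 ≤ x → 0 ≤ p x)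
    (hC : ∀ x, 0 ≤ x → p x ≤ C * ‖x‖) :
    ∃ f : StrongDual ℝ E, ∀ x, 0 ≤ x → f x = p x := by
  -- Every decomposition into positive elements gives the same value, so additivity may be checked
  -- on `x⁺ + y⁺` and `x⁻ + y⁻`.
  have hsub : ∀ x a b : E, 0 ≤ a → 0 ≤ b → x = a - b → p x⁺ - p x⁻ = p a - p b := by
    intro x a b ha hb h
    have h1 : x⁺ + b = a + x⁻ := by
      rw [← sub_eq_sub_iff_add_eq_add, posPart_sub_negPart, h]
    have h2 := hadd _ _ (posPart_nonneg x) hb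
    rw [h1, hadd _ _ ha (negPart_nonneg x)] at h2
    linarith
  let g : E →+ ℝ := AddMonoidHom.mk' (fun x => p x⁺ - p x⁻) fun x y => by
    rw [hsub (x + y) (x⁺ + y⁺) (x⁻ + y⁻) (add_nonneg (posPart_nonneg x) (posPart_nonneg y))
      (add_nonneg (negPart_nonneg x) (negPart_nonneg y)),
      hadd _ _ (posPart_nonneg x) (posPart_nonneg y),
      hadd _ _ (negPart_nonneg x) (negPart_nonneg y)]
    · ring
    · conv_lhs => rw [← posPart_sub_negPart x, ← posPart_sub_negPart y]
      abel
  have hg : Continuous g := by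
    refine AddMonoidHomClass.continuous_of_bound g |C| fun x => ?_
    have h1 := hC _ (posPart_nonneg x)
    have h2 := hC _ (negPart_nonneg x)
    have h3 := hpos _ (posPart_nonneg x)
    have h4 := hpos _ (negPart_nonneg x)
    have h5 : C * ‖x⁺‖ ≤ |C| * ‖x‖ := by
      gcongr
      exacts [le_abs_self C, norm_posPart_le x]
    have h6 : C * ‖x⁻‖ ≤ |C| * ‖x‖ := by
      gcongr
      exacts [le_abs_self C, norm_negPart_le x]
    change |p x⁺ - p x⁻| ≤ _
    rw [abs_le]
    constructor <;> linarith
  -- Continuity upgrades additivity to real linearity.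
  refine ⟨g.toRealLinearMap hg, fun x hx => ?_⟩
  change p x⁺ - p x⁻ = p x
  have h0 : p 0 = 0 := by simpa using hadd 0 0 le_rfl le_rfl
  rw [posPart_of_nonneg hx, negPart_of_nonneg hx, h0, sub_zero]

theorem apply_mono_of_nonneg {f : StrongDual ℝ E} (hf : 0 ≤ f) {x y : E} (h : x ≤ y) :
    f x ≤ f y := by
  simpa using hf (y - x) (sub_nonneg.2 h)

/-- The part of a positive functional carried by the band generated by an increasing sequence. -/
theorem exists_carrier {φ : StrongDual ℝ E} (hφ : 0 ≤ φ) {s : ℕ → E} (hs : Monotone s)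
    (hs0 : ∀ n, 0 ≤ s n) (hs2 : ∀ n, ∃ m, s n + s n ≤ s m) :
    ∃ ψ : StrongDual ℝ E,
      ∀ x, 0 ≤ x → Tendsto (fun n => φ (x ⊓ s n)) atTop (𝓝 (ψ x)) := by
  have hbdd : ∀ x, ∀ n, φ (x ⊓ s n) ≤ φ x := fun x n => apply_mono_of_nonneg hφ inf_le_left
  have hlim : ∀ x, Tendsto (fun n => φ (x ⊓ s n)) atTop (𝓝 (⨆ n, φ (x ⊓ s n))) := fun x =>
    tendsto_atTop_ciSup
      (fun a b hab => apply_mono_of_nonneg hφ (inf_le_inf_left x (hs hab)))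
      ⟨φ x, by rintro _ ⟨n, rfl⟩; exact hbdd x n⟩
  have hle : ∀ x n, φ (x ⊓ s n) ≤ ⨆ n, φ (x ⊓ s n) := fun x n =>
    le_ciSup (f := fun n => φ (x ⊓ s n)) ⟨φ x, by rintro _ ⟨n, rfl⟩; exact hbdd x n⟩ n
  have hnn : ∀ x, 0 ≤ x → ∀ n, 0 ≤ φ (x ⊓ s n) := fun x hx n => hφ _ (le_inf hx (hs0 n))
  obtain ⟨ψ, hψ⟩ := exists_strongDual_of_cone (fun x => ⨆ n, φ (x ⊓ s n)) ‖φ‖ (by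
      intro x y hx hy
      apply le_antisymm
      · refine ciSup_le fun n => ?_
        refine le_trans ?_ (add_le_add (hle x n) (hle y n))
        rw [← map_add]
        refine apply_mono_of_nonneg hφ ?_
        rw [inf_comm, inf_comm x, inf_comm y]
        exact inf_add_le_inf_add_inf (hs0 n) hx hy
      -- Superadditivity is where `hs2` enters: `x ⊓ s n + y ⊓ s n ≤ (x + y) ⊓ (s n + s n)`, and a
      -- later `s m` absorbs the doubling.
      · refine le_of_tendsto ((hlim x).add (hlim y)) (Eventually.of_forall fun n => ?_)
        obtain ⟨m, hm⟩ := hs2 n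
        refine le_trans ?_ (hle (x + y) m)
        rw [← map_add]
        exact apply_mono_of_nonneg hφ
          (le_inf (add_le_add inf_le_left inf_le_left)
            ((add_le_add inf_le_right inf_le_right).trans hm)))
    (fun x hx => (hnn x hx 0).trans (hle x 0))
    (fun x hx => ciSup_le fun n => (hbdd x n).trans ((le_abs_self _).trans (φ.le_opNorm x)))
  exact ⟨ψ, fun x hx => by rw [hψ x hx]; exact hlim x⟩

/-- The parts of a positive functional carried by the bands of a disjoint sequence. -/
theorem exists_disjoint_carriers {φ : StrongDual ℝ E} (hφ : 0 ≤ φ) {u : ℕ → E}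
    (hu : ∀ k, 0 ≤ u k) (hd : Pairwise fun i j => u i ⊓ u j = 0) :
    ∃ ψ : ℕ → StrongDual ℝ E, (∀ k, 0 ≤ ψ k) ∧ (∀ k, ψ k (u k) = φ (u k)) ∧
      ∀ N, ∑ k ∈ Finset.range N, ψ k ≤ φ := by
  have hmono : ∀ k, Monotone fun n : ℕ => n • u k := fun k a b hab =>
    nsmul_le_nsmul_left (hu k) hab
  choose ψ hψ using fun k => exists_carrier hφ (hmono k) (fun n => nsmul_nonneg (hu k) n)
    fun n => ⟨n + n, (add_nsmul _ _ _).ge⟩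
  refine ⟨ψ, fun k x hx => ?_, fun k => ?_, fun N x hx => ?_⟩
  · exact ge_of_tendsto' (hψ k x hx) fun n => hφ _ (le_inf hx (nsmul_nonneg (hu k) n))
  · refine tendsto_nhds_unique (hψ k (u k) (hu k)) (tendsto_const_nhds.congr' ?_)
    filter_upwards [eventually_ge_atTop 1] with n hn
    congr 1
    refine (inf_eq_left.2 ?_).symm
    simpa using nsmul_le_nsmul_left (hu k) hn
  · rw [_root_.sum_apply]
    -- For fixed `n` the elements `x ⊓ n • u k` are pairwise disjoint and below `x`, hence so is
    -- their sum.
    refine le_of_tendsto' (tendsto_finsetSum _ fun k _ => hψ k x hx) fun n => ?_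
    rw [← map_sum]
    refine apply_mono_of_nonneg hφ (sum_le_of_disjoint hx
      (fun k => le_inf hx (nsmul_nonneg (hu k) n)) (fun i j hij => ?_) (fun k => inf_le_left) N)
    refine inf_eq_zero_of_le (le_inf hx (nsmul_nonneg (hu i) n))
      (le_inf hx (nsmul_nonneg (hu j) n)) inf_le_right inf_le_right ?_
    refine inf_nsmul_eq_zero (nsmul_nonneg (hu i) n) (hu j) ?_ n
    rw [inf_comm]
    refine inf_nsmul_eq_zero (hu j) (hu i) (hd hij.symm) n

theorem weaklyNull_of_nonneg {x : ℕ → E}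
    (h : ∀ f : StrongDual ℝ E, 0 ≤ f → Tendsto (fun n => f (x n)) atTop (𝓝 0)) :
    WeaklyNull x := by
  rw [weaklyNull_iff]
  intro f
  have h1 := (h _ (posPart_nonneg f)).sub (h _ (negPart_nonneg f))
  rw [sub_zero] at h1
  refine h1.congr fun n => ?_
  rw [← _root_.sub_apply, posPart_sub_negPart]

theorem WeaklyNull.neg {x : ℕ → E} (hx : WeaklyNull x) : WeaklyNull fun n => -x n := by
  rw [weaklyNull_iff] at hx ⊢
  intro f
  simpa using (hx f).neg

theorem DisjointSeq.neg {x : ℕ → E} (hx : DisjointSeq x) : DisjointSeq fun n => -x n := by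
  intro i j hij
  simpa using hx hij

/-- Positive parts of a disjoint weakly null sequence are weakly null. -/
theorem WeaklyNull.posPart {x : ℕ → E} (hx : WeaklyNull x) (hd : DisjointSeq x) :
    WeaklyNull fun n => (x n)⁺ := by
  refine weaklyNull_of_nonneg fun φ hφ => ?_
  have hpos : ∀ k, 0 ≤ (x k)⁺ := fun k => posPart_nonneg _
  have hS : ∀ n, 0 ≤ ∑ k ∈ Finset.range n, (x k)⁺ := fun n => Finset.sum_nonneg fun k _ => hpos k
  have hSm : Monotone fun n => ∑ k ∈ Finset.range n, (x k)⁺ := fun a b hab =>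
    Finset.sum_le_sum_of_subset_of_nonneg (Finset.range_mono hab) fun k _ _ => hpos k
  -- The band is the one generated by all the positive parts; the factor `n` provides the doubling.
  -- Its part `ψ` of `φ` agrees with `φ` on each `(x j)⁺` and kills each `(x j)⁻`, so `φ (x j)⁺ = ψ
  -- (x j)`, which tends to zero.
  have hsm : Monotone fun n : ℕ => n • ∑ k ∈ Finset.range n, (x k)⁺ := fun a b hab =>
    (nsmul_le_nsmul_left (hS a) hab).trans (nsmul_le_nsmul_right (hSm hab) b)
  obtain ⟨ψ, hψ⟩ := exists_carrier hφ hsm (fun n => nsmul_nonneg (hS n) n) fun n =>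
    ⟨n + n, by
      rw [← add_nsmul]
      exact nsmul_le_nsmul_right (hSm (Nat.le_add_right n n)) _⟩
  refine ((weaklyNull_iff x).1 hx ψ).congr fun j => ?_
  have h1 : ψ (x j)⁺ = φ (x j)⁺ := by
    refine tendsto_nhds_unique (hψ _ (hpos j)) (tendsto_const_nhds.congr' ?_)
    filter_upwards [eventually_ge_atTop (j + 1)] with n hn
    congr 1
    refine (inf_eq_left.2 ?_).symm
    calc (x j)⁺ ≤ ∑ k ∈ Finset.range n, (x k)⁺ :=
          Finset.single_le_sum (fun k _ => hpos k) (Finset.mem_range.2 hn)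
      _ ≤ n • ∑ k ∈ Finset.range n, (x k)⁺ := by
          simpa using nsmul_le_nsmul_left (hS n) (show 1 ≤ n by omega)
  have h2 : ψ (x j)⁻ = 0 := by
    refine tendsto_nhds_unique (hψ _ (negPart_nonneg (x j))) (tendsto_const_nhds.congr fun n => ?_)
    rw [inf_nsmul_eq_zero (negPart_nonneg _) (hS n), map_zero]
    refine inf_sum_eq_zero (negPart_nonneg _) hpos _ fun k _ => ?_
    rcases eq_or_ne k j with rfl | hkj
    · rw [inf_comm]; exact posPart_inf_negPart_eq_zero _
    · exact inf_eq_zero_of_le (negPart_nonneg _) (hpos k) (sup_le (neg_le_abs _) (abs_nonneg _))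
        (sup_le (le_abs_self _) (abs_nonneg _)) (hd hkj.symm)
  rw [← h1, ← sub_zero (ψ (x j)⁺), ← h2, ← map_sub, posPart_sub_negPart]

theorem WeaklyNull.negPart {x : ℕ → E} (hx : WeaklyNull x) (hd : DisjointSeq x) :
    WeaklyNull fun n => (x n)⁻ := by
  simpa using hx.neg.posPart hd.neg

/-- A disjoint weakly null sequence is a difference of two positive weakly null sequences. -/
theorem WeaklyNull.exists_nonneg_sub_nonneg {x : ℕ → E} (hx : WeaklyNull x) (hd : DisjointSeq x) :
    ∃ p q : ℕ → E, (∀ n, 0 ≤ p n) ∧ (∀ n, 0 ≤ q n) ∧ (∀ n, p n - q n = x n) ∧ WeaklyNull p ∧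
      WeaklyNull q :=
  ⟨fun n => (x n)⁺, fun n => (x n)⁻, fun n => posPart_nonneg (x n), fun n => negPart_nonneg (x n),
    fun n => posPart_sub_negPart (x n), hx.posPart hd, hx.negPart hd⟩

end Functionals

/-! ### Domination and boundedness for positive multilinear forms. -/

section PositiveForms

variable {ι : Type*} [Fintype ι] {E : ι → Type*} [∀ i, NormedAddCommGroup (E i)]
  [∀ i, NormedSpace ℝ (E i)] [∀ i, Lattice (E i)] [∀ i, IsOrderedAddMonoid (E i)]

theorem IsPositiveForm.mono {B : MultilinearMap ℝ E ℝ} (hB : IsPositiveForm B) {x y : ∀ i, E i}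
    (hx : ∀ i, 0 ≤ x i) (hxy : ∀ i, x i ≤ y i) : B x ≤ B y := by
  classical
  have key : ∀ s : Finset ι, B x ≤ B (s.piecewise y x) := by
    intro s
    induction s using Finset.induction_on with
    | empty => simp
    | insert a s ha ih =>
      have h0 : ∀ i, 0 ≤ s.piecewise y x i := fun i => by
        by_cases hi : i ∈ s
        · simpa [hi] using (hx i).trans (hxy i)
        · simpa [hi] using hx i
      have h1 : B (Function.update (s.piecewise y x) a (x a)) = B (s.piecewise y x) := by
        congr 1
        rw [Function.update_eq_self_iff]
        simp [ha]
      have h2 : 0 ≤ B (Function.update (s.piecewise y x) a (y a - x a)) := hB _ fun i => by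
        rcases eq_or_ne i a with rfl | hi
        · simpa using hxy i
        · simpa [Function.update_of_ne hi] using h0 i
      rw [B.map_update_sub, h1] at h2
      rw [Finset.piecewise_insert]
      linarith
  simpa using key Finset.univ

theorem IsPositiveForm.abs_apply_le {B : MultilinearMap ℝ E ℝ} (hB : IsPositiveForm B)
    (x : ∀ i, E i) : |B x| ≤ B fun i => |x i| := by
  classical
  -- Induction on a set containing every coordinate of possibly indefinite sign: splitting one
  -- coordinate into its positive and negative parts shrinks it.
  have key : ∀ (s : Finset ι) (x : ∀ i, E i), (∀ i ∉ s, 0 ≤ x i) → |B x| ≤ B fun i => |x i| := by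
    intro s
    induction s using Finset.induction_on with
    | empty =>
      intro x hx
      have h : (fun i => |x i|) = x := funext fun i => abs_of_nonneg (hx i (by simp))
      rw [h, abs_of_nonneg (hB x fun i => hx i (by simp))]
    | insert a s ha ih =>
      intro x hx
      have hup : ∀ c : E a, 0 ≤ c →
          |B (Function.update x a c)| ≤ B (Function.update (fun i => |x i|) a c) := by
        intro c hc
        have h : (fun i => |Function.update x a c i|) = Function.update (fun i => |x i|) a c := by
          ext i
          rcases eq_or_ne i a with rfl | hi
          · simpa using abs_of_nonneg hc
          · simp [Function.update_of_ne hi]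
        rw [← h]
        refine ih _ fun i hi => ?_
        rcases eq_or_ne i a with rfl | hia
        · simpa using hc
        · rw [Function.update_of_ne hia]
          exact hx i (by simp [hi, hia])
      have h1 := hup _ (posPart_nonneg (x a))
      have h2 := hup _ (negPart_nonneg (x a))
      have h3 : B x = B (Function.update x a (x a)⁺) - B (Function.update x a (x a)⁻) := by
        rw [← B.map_update_sub, posPart_sub_negPart, Function.update_eq_self]
      have h4 : (B fun i => |x i|) = B (Function.update (fun i => |x i|) a (x a)⁺) +
          B (Function.update (fun i => |x i|) a (x a)⁻) := by
        rw [← B.map_update_add, posPart_add_negPart]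
        congr 1
        exact (Function.update_eq_self a _).symm
      rw [h3, h4]
      exact (abs_sub _ _).trans (add_le_add h1 h2)
  exact key Finset.univ x fun i hi => absurd (Finset.mem_univ i) hi

variable [∀ i, IsOrderedModule ℝ (E i)] [∀ i, HasSolidNorm (E i)]

theorem IsPositiveForm.abs_apply_le_mul_prod {B : MultilinearMap ℝ E ℝ} (hB : IsPositiveForm B)
    {c : ℝ} (hc : ∀ y : ∀ i, E i, (∀ i, 0 ≤ y i) → (∀ i, ‖y i‖ ≤ 1) → B y ≤ c)
    (x : ∀ i, E i) : |B x| ≤ c * ∏ i, ‖x i‖ := by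
  have hc0 : 0 ≤ c := (hB 0 fun i => le_rfl).trans (hc 0 (fun i => le_rfl) fun i => by simp)
  by_cases h : ∃ i, x i = 0
  · obtain ⟨i, hi⟩ := h
    rw [B.map_coord_zero i hi, abs_zero]
    positivity
  push Not at h
  have h0 : ∀ i, ‖x i‖ ≠ 0 := fun i => norm_ne_zero_iff.2 (h i)
  have h1 : (fun i => |x i|) = fun i => ‖x i‖ • (‖x i‖⁻¹ • |x i|) := by
    ext i
    rw [smul_smul, mul_inv_cancel₀ (h0 i), one_smul]
  refine (hB.abs_apply_le x).trans ?_
  rw [h1, B.map_smul_univ, smul_eq_mul, mul_comm]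
  refine mul_le_mul_of_nonneg_right (hc _ (fun i => ?_) fun i => ?_) (by positivity)
  · exact smul_nonneg (inv_nonneg.2 (norm_nonneg _)) (abs_nonneg _)
  · rw [norm_smul, norm_abs_eq_norm, norm_inv, norm_norm, inv_mul_cancel₀ (h0 i)]

theorem summable_half_pow_smul {F : Type*} [NormedAddCommGroup F] [NormedSpace ℝ F]
    [CompleteSpace F] {w : ℕ → F} {C : ℝ} (hw : ∀ k, ‖w k‖ ≤ C) :
    Summable fun k => (1 / 2 : ℝ) ^ k • w k := by
  refine Summable.of_norm_bounded (summable_geometric_two.mul_right C) fun k => ?_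
  rw [norm_smul, norm_pow, Real.norm_of_nonneg (by norm_num : (0 : ℝ) ≤ 1 / 2)]
  gcongr
  exact hw k

theorem half_pow_smul_le_tsum {F : Type*} [NormedAddCommGroup F] [NormedSpace ℝ F]
    [CompleteSpace F] [Lattice F] [IsOrderedAddMonoid F] [IsOrderedModule ℝ F] [HasSolidNorm F]
    {w : ℕ → F} {C : ℝ} (hw : ∀ k, ‖w k‖ ≤ C) (hw0 : ∀ k, 0 ≤ w k) (k : ℕ) :
    (1 / 2 : ℝ) ^ k • w k ≤ ∑' j, (1 / 2 : ℝ) ^ j • w j :=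
  (summable_half_pow_smul hw).le_tsum k fun j _ => smul_nonneg (by positivity) (hw0 j)

/-- Positive multilinear forms on Banach lattices are bounded. -/
theorem IsPositiveForm.exists_bound [∀ i, CompleteSpace (E i)] {B : MultilinearMap ℝ E ℝ}
    (hB : IsPositiveForm B) : ∃ C : ℝ, ∀ x, ‖B x‖ ≤ C * ∏ i, ‖x i‖ := by
  suffices h : ∃ c : ℝ, ∀ y : ∀ i, E i, (∀ i, 0 ≤ y i) → (∀ i, ‖y i‖ ≤ 1) → B y ≤ c by
    obtain ⟨c, hc⟩ := h
    exact ⟨c, hB.abs_apply_le_mul_prod hc⟩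
  by_contra! h
  -- The threshold cancels the factor `(2 ^ k)⁻¹` lost in each coordinate on scaling. The value at
  -- the sums `∑ 2⁻ʲ x j`, which dominate every scaled vector, would then exceed every `k`.
  choose x hx0 hx1 hx using fun k : ℕ => h (k * (2 ^ k) ^ Fintype.card ι)
  have hle : ∀ k : ℕ, (k : ℝ) ≤ B fun i => ∑' j, (1 / 2 : ℝ) ^ j • x j i := by
    intro k
    have h1 := hB.mono (x := fun i => (1 / 2 : ℝ) ^ k • x k i)
      (fun i => smul_nonneg (by positivity) (hx0 k i))
      fun i => half_pow_smul_le_tsum (fun j => hx1 j i) (fun j => hx0 j i) k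
    refine le_trans ?_ h1
    rw [B.map_smul_univ (fun _ => (1 / 2 : ℝ) ^ k), Finset.prod_const, Finset.card_univ,
      smul_eq_mul]
    calc (k : ℝ) = ((1 / 2 : ℝ) ^ k) ^ Fintype.card ι * (k * (2 ^ k) ^ Fintype.card ι) := by
          rw [mul_left_comm, ← mul_pow, ← mul_pow]
          norm_num
      _ ≤ _ := by gcongr; exact (hx k).le
  obtain ⟨k, hk⟩ := exists_nat_gt (B fun i => ∑' j, (1 / 2 : ℝ) ^ j • x j i)
  exact absurd (hle k) (not_le.2 hk)

/-- Positive forms whose values at bounded sequences of positive vectors tend to `0` tend to `0`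
in norm. -/
theorem tendsto_norm_of_isPositiveForm {B : ℕ → ContinuousMultilinearMap ℝ E ℝ}
    (hB : ∀ k, IsPositiveForm (B k).toMultilinearMap)
    (h : ∀ x : ℕ → ∀ i, E i, (∀ k i, 0 ≤ x k i) → (∀ k i, ‖x k i‖ ≤ 1) →
      Tendsto (fun k => B k (x k)) atTop (𝓝 0)) :
    Tendsto (fun k => ‖B k‖) atTop (𝓝 0) := by
  -- The norm of a positive form is nearly attained at positive vectors of the unit balls; the slack
  -- `1 / (k + 1)` vanishes in the limit.
  have key : ∀ k : ℕ, ∃ y : ∀ i, E i, (∀ i, 0 ≤ y i) ∧ (∀ i, ‖y i‖ ≤ 1) ∧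
      ‖B k‖ ≤ B k y + 1 / ((k : ℝ) + 1) := by
    intro k
    by_contra! hcon
    have hc : ∀ y : ∀ i, E i, (∀ i, 0 ≤ y i) → (∀ i, ‖y i‖ ≤ 1) →
        (B k).toMultilinearMap y ≤ ‖B k‖ - 1 / ((k : ℝ) + 1) := fun y hy0 hy1 => by
      have := hcon y hy0 hy1
      rw [ContinuousMultilinearMap.coe_coe]
      linarith
    have h0 : 0 ≤ ‖B k‖ - 1 / ((k : ℝ) + 1) :=
      (hB k 0 fun i => le_rfl).trans (hc 0 (fun i => le_rfl) fun i => by simp)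
    have h1 := (B k).opNorm_le_bound h0 ((hB k).abs_apply_le_mul_prod hc)
    have h2 : 0 < 1 / ((k : ℝ) + 1) := by positivity
    linarith
  choose y hy0 hy1 hy using key
  refine squeeze_zero (fun k => norm_nonneg _) hy ?_
  simpa using (h y hy0 hy1).add tendsto_one_div_add_atTop_nhds_zero_nat

end PositiveForms

/-! ### Contraction of the last variable preserves positivity. -/

section BidualBar

universe u

theorem snoc_nonneg {n : ℕ} {E : Fin (n + 1) → Type u} [∀ i, Zero (E i)] [∀ i, LE (E i)]
    {x : ∀ i : Fin n, E i.castSucc} {a : E (Fin.last n)} (hx : ∀ i, 0 ≤ x i) (ha : 0 ≤ a) :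
    ∀ i, 0 ≤ (Fin.snoc x a : ∀ i, E i) i := fun i => by
  induction i using Fin.lastCases with
  | last => simpa using ha
  | cast i => simpa using hx i

variable {n : ℕ} {E : Fin (n + 1) → Type u} [∀ i, NormedAddCommGroup (E i)]
  [∀ i, NormedSpace ℝ (E i)] [∀ i, Lattice (E i)] [∀ i, IsOrderedAddMonoid (E i)]
  [∀ i, HasSolidNorm (E i)]

theorem curryRight_nonneg {A : ContinuousMultilinearMap ℝ E ℝ}
    (hA : IsPositiveForm A.toMultilinearMap) {x : ∀ i : Fin n, E i.castSucc}
    (hx : ∀ i, 0 ≤ x i) : 0 ≤ A.curryRight x :=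
  fun _ ha => hA _ (snoc_nonneg hx ha)

theorem isPositiveForm_bidualBar {A : ContinuousMultilinearMap ℝ E ℝ}
    (hA : IsPositiveForm A.toMultilinearMap) {z : Bidual (E (Fin.last n))} (hz : 0 ≤ z) :
    IsPositiveForm (bidualBar z A).toMultilinearMap :=
  fun _ hx => hz _ (curryRight_nonneg hA hx)

end BidualBar

/-! ### Dominated series of positive forms. -/

section Summing

universe u

/-- Let `B k` be positive forms whose partial sums are bounded above by a form. If the duals of the
lattices have the positive Schur property, then `B k (x k)` tends to `0` for every bounded sequence
of positive vectors. -/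
theorem tendsto_apply_of_sum_le : ∀ (n : ℕ) (E : Fin n → Type u) [∀ i, NormedAddCommGroup (E i)]
    [∀ i, NormedSpace ℝ (E i)] [∀ i, Lattice (E i)] [∀ i, IsOrderedAddMonoid (E i)]
    [∀ i, HasSolidNorm (E i)] (_ : ∀ i, PositiveSchur (StrongDual ℝ (E i)))
    (B : ℕ → ContinuousMultilinearMap ℝ E ℝ) (D : ContinuousMultilinearMap ℝ E ℝ)
    (_ : ∀ k, IsPositiveForm (B k).toMultilinearMap)
    (_ : ∀ N x, (∀ i, 0 ≤ x i) → ∑ k ∈ Finset.range N, B k x ≤ D x)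
    (x : ℕ → ∀ i, E i) (_ : ∀ k i, 0 ≤ x k i) (_ : ∀ k i, ‖x k i‖ ≤ 1),
    Tendsto (fun k => B k (x k)) atTop (𝓝 0)
  | 0, E, _, _, _, _, _, _, B, D, hB, hD, x, _, _ => by
    -- With no variables left, the forms are nonnegative numbers with bounded partial sums.
    have hx : ∀ k, x k = 0 := fun k => Subsingleton.elim _ _
    simp only [hx]
    refine Summable.tendsto_atTop_zero (summable_of_sum_range_le (c := D 0)
      (fun k => hB k 0 fun i => le_rfl) fun N => ?_)
    exact hD N 0 fun i => le_rfl
  | n + 1, E, _, _, _, _, _, hE, B, D, hB, hD, x, hx0, hx1 => by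
    have hwn : WeaklyNull fun k => (B k).curryRight fun i => x k i.castSucc := by
      -- Contraction with a positive `z` keeps the domination, now by `bidualBar z D`, and leaves
      -- one variable fewer.
      refine weaklyNull_of_nonneg fun z hz => ?_
      refine tendsto_apply_of_sum_le n (fun i => E i.castSucc) (fun i => hE _)
        (fun k => bidualBar z (B k)) (bidualBar z D) (fun k => isPositiveForm_bidualBar (hB k) hz)
        (fun N y hy => ?_) (fun k i => x k i.castSucc) (fun k i => hx0 k _) fun k i => hx1 k _
      simp only [bidualBar_apply]
      rw [← map_sum]
      refine apply_mono_of_nonneg hz fun a ha => ?_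
      rw [_root_.sum_apply]
      exact hD N _ (snoc_nonneg hy ha)
    have hlim := hE (Fin.last n) _ (fun k => curryRight_nonneg (hB k) fun i => hx0 k _) hwn
    refine squeeze_zero_norm (fun k => ?_) (tendsto_zero_iff_norm_tendsto_zero.1 hlim)
    have h : B k (x k) = (B k).curryRight (fun i => x k i.castSucc) (x k (Fin.last n)) := by
      rw [ContinuousMultilinearMap.curryRight_apply]
      congr 1
      exact (Fin.snoc_init_self (x k)).symm
    rw [h]
    refine (ContinuousLinearMap.le_opNorm _ _).trans ?_
    exact mul_le_of_le_one_right (norm_nonneg _) (hx1 k _)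

end Summing

/-! ### Disjointification of a bounded positive sequence. -/

section Disjointification

variable {F : Type*} [NormedAddCommGroup F] [NormedSpace ℝ F] [Lattice F] [IsOrderedAddMonoid F]
  [IsOrderedModule ℝ F] [HasSolidNorm F] [CompleteSpace F]

/-- The disjointification of a bounded sequence of positive vectors. -/
theorem pairwise_disjoint_posPart_sub {w : ℕ → F} {C : ℝ} (hw0 : ∀ k, 0 ≤ w k)
    (hw : ∀ k, ‖w k‖ ≤ C) :
    Pairwise fun i j =>
      (w i - (4 : ℝ) ^ i • ∑ l ∈ Finset.range i, w l -
          (1 / 2 : ℝ) ^ i • ∑' l, (1 / 2 : ℝ) ^ l • w l)⁺ ⊓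
        (w j - (4 : ℝ) ^ j • ∑ l ∈ Finset.range j, w l -
          (1 / 2 : ℝ) ^ j • ∑' l, (1 / 2 : ℝ) ^ l • w l)⁺ = 0 := by
  set W := ∑' l, (1 / 2 : ℝ) ^ l • w l with hWdef
  have hS : ∀ k, 0 ≤ ∑ l ∈ Finset.range k, w l := fun k => Finset.sum_nonneg fun l _ => hw0 l
  have hle : ∀ k, (1 / 2 : ℝ) ^ k • w k ≤ W := half_pow_smul_le_tsum hw hw0
  have hW : 0 ≤ W := (smul_nonneg (by positivity) (hw0 0)).trans (hle 0)
  have key : ∀ i j, i < j →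
      (w i - (4 : ℝ) ^ i • ∑ l ∈ Finset.range i, w l - (1 / 2 : ℝ) ^ i • W)⁺ ⊓
        (w j - (4 : ℝ) ^ j • ∑ l ∈ Finset.range j, w l - (1 / 2 : ℝ) ^ j • W)⁺ = 0 := by
    intro i j hij
    -- The two terms are compared with the disjoint elements `a⁺` and `4 ^ j • a⁻`. For the second,
    -- `i < j` puts `w i` inside the subtracted sum, and `w j ≤ 2 ^ j • W ≤ (4 ^ j * (1 / 2) ^ i) •
    -- W`.
    set a := w i - (1 / 2 : ℝ) ^ i • W with ha
    refine inf_eq_zero_of_le (a := a⁺) (b := (4 ^ j : ℕ) • a⁻) (posPart_nonneg _)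
      (posPart_nonneg _) (posPart_mono ?_) ?_
      (inf_nsmul_eq_zero (posPart_nonneg _) (negPart_nonneg _) (posPart_inf_negPart_eq_zero a) _)
    · rw [ha]
      exact sub_le_sub_right (sub_le_self _ (smul_nonneg (by positivity) (hS i))) _
    · refine sup_le ?_ (nsmul_nonneg (negPart_nonneg _) _)
      have h1 : w i ≤ ∑ l ∈ Finset.range j, w l :=
        Finset.single_le_sum (fun l _ => hw0 l) (Finset.mem_range.2 hij)
      have h2 : w j ≤ ((4 : ℝ) ^ j * (1 / 2) ^ i) • W := by
        have h3 : w j = (2 : ℝ) ^ j • ((1 / 2 : ℝ) ^ j • w j) := by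
          rw [smul_smul, ← mul_pow]
          norm_num
        rw [h3]
        refine (smul_le_smul_of_nonneg_left (hle j) (by positivity)).trans ?_
        refine smul_le_smul_of_nonneg_right ?_ hW
        calc (2 : ℝ) ^ j = 4 ^ j * (1 / 2) ^ j := by rw [← mul_pow]; norm_num
          _ ≤ 4 ^ j * (1 / 2) ^ i := by
            gcongr 4 ^ j * ?_
            exact pow_le_pow_of_le_one (by norm_num) (by norm_num) hij.le
      have h4 : (4 ^ j : ℕ) • -a ≤ (4 ^ j : ℕ) • a⁻ :=
        nsmul_le_nsmul_right (neg_le_negPart a) _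
      refine le_trans ?_ h4
      rw [← Nat.cast_smul_eq_nsmul ℝ, Nat.cast_pow, Nat.cast_ofNat, ha, neg_sub, smul_sub,
        smul_smul]
      refine (sub_le_self _ (smul_nonneg (by positivity) hW)).trans ?_
      exact sub_le_sub h2 (smul_le_smul_of_nonneg_left h1 (by positivity))
  intro i j hij
  rcases lt_or_gt_of_ne hij with h | h
  · exact key i j h
  · rw [inf_comm]; exact key j i h

end Disjointification

/-! ### The contradiction argument for positive forms. -/

section Core

universe u

variable {m : ℕ} {E : Fin (m + 1) → Type u}
  [∀ i, NormedAddCommGroup (E i)] [∀ i, NormedSpace ℝ (E i)] [∀ i, Lattice (E i)]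
  [∀ i, IsOrderedAddMonoid (E i)] [∀ i, HasSolidNorm (E i)]

theorem exists_norm_bound_of_weakStarNull {F : Type*} [NormedAddCommGroup F] [NormedSpace ℝ F]
    [CompleteSpace F] {z : ℕ → StrongDual ℝ F} (hz : WeakStarNull z) : ∃ C, ∀ n, ‖z n‖ ≤ C := by
  refine banach_steinhaus fun x => ?_
  obtain ⟨C, hC⟩ := ((weakStarNull_iff z).1 hz x).norm.bddAbove_range
  exact ⟨C, fun n => hC ⟨n, rfl⟩⟩

theorem exists_norm_bound_of_weaklyNull {F : Type*} [NormedAddCommGroup F] [NormedSpace ℝ F]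
    {x : ℕ → F} (hx : WeaklyNull x) : ∃ C, ∀ n, ‖x n‖ ≤ C := by
  have h : WeakStarNull fun n => NormedSpace.inclusionInDoubleDual ℝ F (x n) :=
    (weakStarNull_iff _).2 fun f => by simpa using (weaklyNull_iff x).1 hx f
  obtain ⟨C, hC⟩ := exists_norm_bound_of_weakStarNull h
  exact ⟨C, fun n => by
    simpa using! ((NormedSpace.inclusionInDoubleDualLi (E := F) ℝ).norm_map (x n)).symm.trans_le
      (hC n)⟩

theorem norm_curryRight_apply_le (A : ContinuousMultilinearMap ℝ E ℝ)
    {x : ∀ i : Fin m, E i.castSucc} (hx : ∀ i, ‖x i‖ ≤ 1) : ‖A.curryRight x‖ ≤ ‖A‖ := by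
  refine (A.curryRight.le_opNorm x).trans ?_
  rw [ContinuousMultilinearMap.curryRight_norm]
  exact mul_le_of_le_one_right (norm_nonneg _)
    (Finset.prod_le_one (fun i _ => norm_nonneg _) fun i _ => hx i)

/-- A disjoint sequence of positive functionals `y k ≤ A (x k, •)` is weakly null. -/
theorem weaklyNull_of_disjoint_le_curryRight (hE : ∀ i, PositiveSchur (StrongDual ℝ (E i)))
    {A : ContinuousMultilinearMap ℝ E ℝ} (hA : IsPositiveForm A.toMultilinearMap)
    {x : ℕ → ∀ i : Fin m, E i.castSucc} (hx0 : ∀ k i, 0 ≤ x k i) (hx1 : ∀ k i, ‖x k i‖ ≤ 1)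
    {y : ℕ → StrongDual ℝ (E (Fin.last m))} (hy0 : ∀ k, 0 ≤ y k)
    (hyd : Pairwise fun i j => y i ⊓ y j = 0) (hy : ∀ k, y k ≤ A.curryRight (x k)) :
    WeaklyNull y := by
  refine weaklyNull_of_nonneg fun φ hφ => ?_
  -- The `ψ k` replace the single `φ` by a dominated series without changing the values `φ (y k)`,
  -- so the summing lemma applies in the first `m` variables.
  obtain ⟨ψ, hψ0, hψ, hψs⟩ := exists_disjoint_carriers hφ hy0 hyd
  refine squeeze_zero (fun k => hφ _ (hy0 k))
    (fun k => (hψ k).symm.trans_le (apply_mono_of_nonneg (hψ0 k) (hy k)))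
    (tendsto_apply_of_sum_le m (fun i => E i.castSucc) (fun i => hE _)
      (fun k => bidualBar (ψ k) A) (bidualBar φ A) (fun k => isPositiveForm_bidualBar hA (hψ0 k))
      (fun N v hv => ?_) x hx0 hx1)
  have h := hψs N _ (curryRight_nonneg hA hv)
  rwa [_root_.sum_apply] at h

theorem tendsto_bidualBar_apply (hE : ∀ i, PositiveSchur (StrongDual ℝ (E i)))
    {A : ContinuousMultilinearMap ℝ E ℝ} (hA : IsPositiveForm A.toMultilinearMap)
    {z : ℕ → Bidual (E (Fin.last m))} (hz0 : ∀ n, 0 ≤ z n) (hz : WeakStarNull z)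
    {x : ℕ → ∀ i : Fin m, E i.castSucc} (hx0 : ∀ k i, 0 ≤ x k i) (hx1 : ∀ k i, ‖x k i‖ ≤ 1) :
    Tendsto (fun n => bidualBar (z n) A (x n)) atTop (𝓝 0) := by
  obtain ⟨C, hC⟩ := exists_norm_bound_of_weakStarNull hz
  set v : ℕ → StrongDual ℝ (E (Fin.last m)) := fun n => A.curryRight (x n) with hv
  change Tendsto (fun n => z n (v n)) atTop (𝓝 0)
  have hv0 : ∀ n, 0 ≤ v n := fun n => curryRight_nonneg hA (hx0 n)
  have hv1 : ∀ n, ‖v n‖ ≤ ‖A‖ := fun n => norm_curryRight_apply_le A (hx1 n)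
  by_contra hcon
  obtain ⟨ε, hε, hfreq⟩ : ∃ ε > 0, ∃ᶠ n in atTop, ε ≤ z n (v n) := by
    by_contra! h
    refine hcon (tendsto_order.2 ⟨fun a ha => Eventually.of_forall fun n =>
      ha.trans_le (hz0 n _ (hv0 n)), fun a ha => ?_⟩)
    simpa using h a ha
  -- Weak*-nullity at the fixed functional `S` beats the factor `4 ^ k`. The indices obtained need
  -- not increase with `k`.
  have hstep : ∀ (k : ℕ) (S : StrongDual ℝ (E (Fin.last m))),
      ∃ n, ε ≤ z n (v n) ∧ (4 : ℝ) ^ k * z n S < (1 / 2) ^ k := by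
    intro k S
    have h : Tendsto (fun n => (4 : ℝ) ^ k * z n S) atTop (𝓝 0) := by
      simpa using ((weakStarNull_iff z).1 hz S).const_mul ((4 : ℝ) ^ k)
    exact (hfreq.and_eventually (h.eventually (gt_mem_nhds (by positivity)))).exists
  choose g hg1 hg2 using hstep
  -- The index at stage `k` depends on the sum of the functionals already selected, so the sums are
  -- built recursively before `w` is named.
  let S : ℕ → StrongDual ℝ (E (Fin.last m)) := fun k =>
    Nat.rec 0 (fun k T => T + v (g k T)) k
  let w : ℕ → StrongDual ℝ (E (Fin.last m)) := fun k => v (g k (S k))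
  have hS : ∀ k, S k = ∑ j ∈ Finset.range k, w j := by
    intro k
    induction k with
    | zero => rfl
    | succ k ih => rw [Finset.sum_range_succ, ← ih]
  have hw0 : ∀ k, 0 ≤ w k := fun k => hv0 _
  have hw1 : ∀ k, ‖w k‖ ≤ ‖A‖ := fun k => hv1 _
  set W := ∑' l, (1 / 2 : ℝ) ^ l • w l with hW
  have hW0 : 0 ≤ W := tsum_nonneg fun l => smul_nonneg (by positivity) (hw0 l)
  have hd := pairwise_disjoint_posPart_sub hw0 hw1
  rw [← hW] at hd
  set y : ℕ → StrongDual ℝ (E (Fin.last m)) := fun k =>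
    (w k - (4 : ℝ) ^ k • ∑ l ∈ Finset.range k, w l - (1 / 2 : ℝ) ^ k • W)⁺ with hy
  have hy0 : ∀ k, 0 ≤ y k := fun k => posPart_nonneg _
  have hyw : ∀ k, y k ≤ w k := fun k => sup_le
    ((sub_le_self _ (smul_nonneg (by positivity) hW0)).trans
      (sub_le_self _ (smul_nonneg (by positivity) (Finset.sum_nonneg fun l _ => hw0 l)))) (hw0 k)
  have hylim : Tendsto (fun k => ‖y k‖) atTop (𝓝 0) :=
    tendsto_zero_iff_norm_tendsto_zero.1 (hE _ y hy0
      (weaklyNull_of_disjoint_le_curryRight hE hA (x := fun k => x (g k (S k)))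
        (fun k => hx0 _) (fun k => hx1 _) hy0 hd hyw))
  -- The chosen `z` is applied to `w k ≤ y k + 4 ^ k • S k + 2⁻ᵏ • W`; the middle term is below
  -- `2⁻ᵏ` by the choice of index.
  have hbound : ∀ k, ε ≤ C * ‖y k‖ + ((1 / 2 : ℝ) ^ k + (1 / 2 : ℝ) ^ k * (C * ‖W‖)) := by
    intro k
    have h1 : w k ≤ y k + (4 : ℝ) ^ k • S k + (1 / 2 : ℝ) ^ k • W := by
      rw [← sub_le_iff_le_add, ← sub_le_iff_le_add, hS, sub_right_comm]
      exact le_posPart _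
    have h2 := apply_mono_of_nonneg (hz0 (g k (S k))) h1
    rw [map_add, map_add, map_smul, map_smul, smul_eq_mul, smul_eq_mul] at h2
    have h3 : ∀ f, z (g k (S k)) f ≤ C * ‖f‖ := fun f =>
      (le_abs_self _).trans ((z _).le_of_opNorm_le (hC _) f)
    have h4 := mul_le_mul_of_nonneg_left (h3 W) (by positivity : (0 : ℝ) ≤ (1 / 2) ^ k)
    have h5 := h3 (y k)
    have h6 : ε ≤ z (g k (S k)) (w k) := hg1 k (S k)
    have h7 := hg2 k (S k)
    linarith
  have hpow : Tendsto (fun k : ℕ => (1 / 2 : ℝ) ^ k) atTop (𝓝 0) :=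
    tendsto_pow_atTop_nhds_zero_of_lt_one (by norm_num) (by norm_num)
  have hlim := (hylim.const_mul C).add (hpow.add (hpow.mul_const (C * ‖W‖)))
  simp only [mul_zero, zero_mul, add_zero] at hlim
  exact absurd (ge_of_tendsto' hlim hbound) (not_le.2 hε)

end Core

/-! ### Norm convergence of the contracted forms, for regular forms. -/

section Regular

universe u

variable {m : ℕ} {E : Fin (m + 1) → Type u}
  [∀ i, NormedAddCommGroup (E i)] [∀ i, NormedSpace ℝ (E i)] [∀ i, Lattice (E i)]
  [∀ i, IsOrderedAddMonoid (E i)] [∀ i, IsOrderedModule ℝ (E i)] [∀ i, HasSolidNorm (E i)]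

/-- Since the vectors may vary with `n`, the preceding convergence is uniform on the positive parts
of the unit balls, which for positive forms amounts to norm convergence. -/
theorem tendsto_norm_bidualBar_of_isPositiveForm (hE : ∀ i, PositiveSchur (StrongDual ℝ (E i)))
    {A : ContinuousMultilinearMap ℝ E ℝ} (hA : IsPositiveForm A.toMultilinearMap)
    {z : ℕ → Bidual (E (Fin.last m))} (hz0 : ∀ n, 0 ≤ z n) (hz : WeakStarNull z) :
    Tendsto (fun n => ‖bidualBar (z n) A‖) atTop (𝓝 0) :=
  tendsto_norm_of_isPositiveForm (fun n => isPositiveForm_bidualBar hA (hz0 n)) fun _ hx0 hx1 =>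
    tendsto_bidualBar_apply hE hA hz0 hz hx0 hx1

/-- A regular form on Banach lattices is a difference of two continuous positive forms. -/
theorem IsRegularForm.exists_continuous [∀ i, CompleteSpace (E i)]
    {A : ContinuousMultilinearMap ℝ E ℝ} (hA : IsRegularForm A.toMultilinearMap) :
    ∃ A₁ A₂ : ContinuousMultilinearMap ℝ E ℝ, IsPositiveForm A₁.toMultilinearMap ∧
      IsPositiveForm A₂.toMultilinearMap ∧ A = A₁ + (-1 : ℝ) • A₂ := by
  obtain ⟨B₁, B₂, h₁, h₂, h⟩ := hA
  obtain ⟨C₁, hC₁⟩ := h₁.exists_bound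
  obtain ⟨C₂, hC₂⟩ := h₂.exists_bound
  refine ⟨B₁.mkContinuous C₁ hC₁, B₂.mkContinuous C₂ hC₂, h₁, h₂, ?_⟩
  ext x
  have hx := congrArg (fun B => B x) h
  simpa [sub_eq_add_neg] using hx

theorem IsRegularForm.tendsto_bidualBar [∀ i, CompleteSpace (E i)]
    (hE : ∀ i, PositiveSchur (StrongDual ℝ (E i)))
    {A : ContinuousMultilinearMap ℝ E ℝ} (hA : IsRegularForm A.toMultilinearMap)
    {z : ℕ → Bidual (E (Fin.last m))} (hz0 : ∀ n, 0 ≤ z n) (hz : WeakStarNull z) :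
    Tendsto (fun n => bidualBar (z n) A) atTop (𝓝 0) := by
  obtain ⟨A₁, A₂, h₁, h₂, rfl⟩ := hA.exists_continuous
  simp only [bidualBar_apply_add, bidualBar_apply_smul]
  have l₁ := tendsto_zero_iff_norm_tendsto_zero.2
    (tendsto_norm_bidualBar_of_isPositiveForm hE h₁ hz0 hz)
  have l₂ := tendsto_zero_iff_norm_tendsto_zero.2
    (tendsto_norm_bidualBar_of_isPositiveForm hE h₂ hz0 hz)
  simpa using l₁.add (l₂.const_smul (-1 : ℝ))

/-- Serves the almost Dunford-Pettis claims, where the last sequence is not positive but splits into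
positive null sequences. -/
theorem IsRegularForm.tendsto_bidualBar_of_sub [∀ i, CompleteSpace (E i)]
    (hE : ∀ i, PositiveSchur (StrongDual ℝ (E i)))
    {A : ContinuousMultilinearMap ℝ E ℝ} (hA : IsRegularForm A.toMultilinearMap)
    {z p q : ℕ → Bidual (E (Fin.last m))} (hz : ∀ n, p n - q n = z n)
    (hp0 : ∀ n, 0 ≤ p n) (hp : WeakStarNull p)
    (hq0 : ∀ n, 0 ≤ q n) (hq : WeakStarNull q) :
    Tendsto (fun n => bidualBar (z n) A) atTop (𝓝 0) := by
  simp only [← hz]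
  simpa using! (hA.tendsto_bidualBar hE hp0 hp).sub (hA.tendsto_bidualBar hE hq0 hq)

end Regular

/-! ### Norm estimate for the extension, and the theorem. -/

section AronBernerNorm

universe u

theorem norm_aronBernerFun_le : ∀ (n : ℕ) (E : Fin n → Type u) [∀ i, NormedAddCommGroup (E i)]
    [∀ i, NormedSpace ℝ (E i)] (A : ContinuousMultilinearMap ℝ E ℝ) (z : ∀ i, Bidual (E i)),
    ‖aronBernerFun n E A z‖ ≤ ‖A‖ * ∏ i, ‖z i‖
  | 0, E, _, _, A, z => by simpa using! A.le_opNorm fun i => i.elim0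
  | n + 1, E, _, _, A, z => by
    refine (norm_aronBernerFun_le n _ (bidualBar (z (Fin.last n)) A) fun i => z i.castSucc).trans ?_
    have h : ‖bidualBar (z (Fin.last n)) A‖ ≤ ‖z (Fin.last n)‖ * ‖A‖ := by
      rw [← ContinuousMultilinearMap.curryRight_norm A]
      exact ContinuousLinearMap.norm_compContinuousMultilinearMap_le _ _
    rw [Fin.prod_univ_castSucc]
    calc _ ≤ ‖z (Fin.last n)‖ * ‖A‖ * ∏ i : Fin n, ‖z i.castSucc‖ := by gcongr
      _ = _ := by ring

/-- Norm null forms take bounded sequences to null sequences. -/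
theorem tendsto_zero_of_norm_le_mul_prod {ι : Type*} [Fintype ι] {E : ι → Type*}
    [∀ i, NormedAddCommGroup (E i)] {G : Type*} [NormedAddCommGroup G] {b : ℕ → G}
    (hb : Tendsto b atTop (𝓝 0)) {z : ∀ i, ℕ → E i} (hz : ∀ i, ∃ C, ∀ n, ‖z i n‖ ≤ C)
    {a : ℕ → ℝ} (ha : ∀ n, ‖a n‖ ≤ ‖b n‖ * ∏ i, ‖z i n‖) : Tendsto a atTop (𝓝 0) := by
  choose C hC using hz
  refine squeeze_zero_norm (a := fun n => ‖b n‖ * ∏ i, C i) (fun n => (ha n).trans ?_) ?_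
  · gcongr
    exact hC _ n
  · simpa using hb.norm.mul_const (∏ i, C i)

end AronBernerNorm

theorem theorem3p9 {m : ℕ} {E : Fin (m + 1) → Type*}
    [∀ i, NormedAddCommGroup (E i)] [∀ i, NormedSpace ℝ (E i)] [∀ i, Lattice (E i)]
    [∀ i, IsOrderedAddMonoid (E i)] [∀ i, IsOrderedModule ℝ (E i)] [∀ i, HasSolidNorm (E i)]
    [∀ i, CompleteSpace (E i)]
    (hE : ∀ i, PositiveSchur (StrongDual ℝ (E i)))
    (A : ContinuousMultilinearMap ℝ E ℝ) (hA : IsRegularForm A.toMultilinearMap) :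
    (∀ z : ∀ i, ℕ → Bidual (E i),
        (∀ n, 0 ≤ z (Fin.last m) n) → WeakStarNull (z (Fin.last m)) →
        (∀ i, i ≠ Fin.last m → Bornology.IsBounded (Set.range (z i))) →
        Tendsto (fun n => aronBerner A fun i => z i n) atTop (𝓝 0)) ∧
      AlmostDunfordPettis A.toMultilinearMap ∧
      AlmostDunfordPettis (E := fun i => Bidual (E i)) (aronBerner A) := by
  refine ⟨fun z hz0 hz hb => ?_, fun x hd hx => ?_, fun z hd hz => ?_⟩
  · refine tendsto_zero_of_norm_le_mul_prod (hA.tendsto_bidualBar hE hz0 hz)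
      (z := fun (i : Fin m) n => z i.castSucc n) (fun i => ?_)
      fun n => norm_aronBernerFun_le m _ _ _
    obtain ⟨C, hC⟩ := (hb _ (Fin.castSucc_lt_last i).ne).exists_norm_le
    exact ⟨C, fun n => hC _ ⟨n, rfl⟩⟩
  -- The canonical embedding is positive and turns weakly null sequences into weak*-null ones;
  -- contracting with an embedded vector is plain evaluation of `A`.
  · have hJ : ∀ {v : ℕ → E (Fin.last m)}, WeaklyNull v →
        WeakStarNull fun n => NormedSpace.inclusionInDoubleDual ℝ _ (v n) := fun hv =>
      (weakStarNull_iff _).2 fun f => by simpa using (weaklyNull_iff _).1 hv f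
    obtain ⟨p, q, hp0, hq0, hpq, hp, hq⟩ := (hx (Fin.last m)).exists_nonneg_sub_nonneg (hd _)
    have h := hA.tendsto_bidualBar_of_sub hE
      (z := fun n => NormedSpace.inclusionInDoubleDual ℝ _ (x (Fin.last m) n))
      (fun n => ContinuousLinearMap.ext fun f =>
        (map_sub f (p n) (q n)).symm.trans (congrArg f (hpq n)))
      (fun n f hf => hf _ (hp0 n)) (hJ hp) (fun n f hf => hf _ (hq0 n)) (hJ hq)
    refine tendsto_zero_of_norm_le_mul_prod h (z := fun (i : Fin m) n => x i.castSucc n)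
      (fun i => exists_norm_bound_of_weaklyNull (hx _)) fun n => ?_
    refine le_of_eq_of_le (congrArg _ ?_) (ContinuousMultilinearMap.le_opNorm _ _)
    rw [bidualBar_apply, NormedSpace.dual_def, ContinuousMultilinearMap.curryRight_apply]
    exact congrArg A (Fin.snoc_init_self fun i => x i n).symm
  -- Weak nullity in the bidual is tested here only on the functionals coming from the dual.
  · have hJ : ∀ {v : ℕ → Bidual (E (Fin.last m))}, WeaklyNull v → WeakStarNull v := fun hv =>
      (weakStarNull_iff _).2 fun f => by
        simpa using (weaklyNull_iff _).1 hv (NormedSpace.inclusionInDoubleDual ℝ _ f)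
    obtain ⟨p, q, hp0, hq0, hpq, hp, hq⟩ :=
      WeaklyNull.exists_nonneg_sub_nonneg (E := Bidual (E (Fin.last m))) (hz _) (hd _)
    have h := hA.tendsto_bidualBar_of_sub hE hpq hp0 (hJ hp) hq0 (hJ hq)
    exact tendsto_zero_of_norm_le_mul_prod h (z := fun (i : Fin m) n => z i.castSucc n)
      (fun i => exists_norm_bound_of_weaklyNull (hz _)) fun n => norm_aronBernerFun_le m _ _ _
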